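/- Let $n\ge 1$. A permutation $\sigma=a_1a_2\cdots a_n$ of $\{1,\dots,n\}$, written in one-line notation, contains a pattern $\pi\in\mathfrak S_k$ if some (not necessarily contiguous) subsequence of $a_1a_2\cdots a_n$ of length $k$ has its entries in the same relative order as those of $\pi$; otherwise $\sigma$ avoids $\pi$. Let \[P_n(132,312)=\operatorname{conv}\{(a_1,\dots,a_n)\in\mathbb R^n : a_1a_2\cdots a_n\in\mathfrak S_n \text{ avoids both } 132 \text{ and } 312\}.\] Then the number of points of $\mathbb Z^n$ in the relative interior of $P_n(132,312)$ (its interior as a subset of its affine span) equals the number of derangements (permutations without fixed points) in $\mathfrak S_{n-1}$. -/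

import Mathlib

namespace PatternPolytope

/-- A permutation in one-line notation `a₁ a₂ ⋯ aₖ` of some length `k`: an element of the disjoint
union of all the symmetric groups.  Positions and values are indexed by `Fin k`, that is, they
are shifted down by one. -/
abbrev Pattern : Type := Σ k : ℕ, Equiv.Perm (Fin k)

/-- `σ` contains the pattern `π`: some (not necessarily contiguous) subsequence of
the one-line notation of `σ`, at the positions `f 0 < f 1 < ⋯`, has its entries in the same relative
order as those of `π`. -/
def Contains {n : ℕ} (σ : Equiv.Perm (Fin n)) (π : Pattern) : Prop :=
  ∃ f : Fin π.1 ↪o Fin n, ∀ i j : Fin π.1, σ (f i) < σ (f j) ↔ π.2 i < π.2 j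

/-- `Av n Q`: the permutations in `𝔖ₙ` that avoid every pattern in `Q`. -/
def Av (n : ℕ) (Q : Set Pattern) : Set (Equiv.Perm (Fin n)) :=
  {σ | ∀ π ∈ Q, ¬ Contains σ π}

/-- The point `(a₁, …, aₙ)` of `ℝⁿ` given by the one-line notation of a permutation of `1, …, n`. -/
def toPoint {n : ℕ} (σ : Equiv.Perm (Fin n)) : Fin n → ℝ :=
  fun i => ((σ i : ℕ) : ℝ) + 1

/-- The `Q`-avoiding permutohedron `Pₙ(Q)`. -/
def avoidingPermutohedron (n : ℕ) (Q : Set Pattern) : Set (Fin n → ℝ) :=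
  convexHull ℝ (toPoint '' Av n Q)

/-- The lattice points of a set: its points with integer coordinates. -/
def latticePoints {n : ℕ} (S : Set (Fin n → ℝ)) : Set (Fin n → ℝ) :=
  {x | x ∈ S ∧ ∃ z : Fin n → ℤ, ∀ i, x i = (z i : ℝ)}

/-- The pattern `132`. -/
def pattern132 : Pattern :=
  ⟨3, { toFun := ![0, 2, 1], invFun := ![0, 2, 1],
        left_inv := by decide, right_inv := by decide }⟩

/-- The pattern `312`. -/
def pattern312 : Pattern :=
  ⟨3, { toFun := ![2, 0, 1], invFun := ![1, 2, 0],
        left_inv := by decide, right_inv := by decide }⟩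

end PatternPolytope

/-!
A permutation avoids `132` and `312` exactly when each entry is larger than all earlier entries or
smaller than all of them. Recording these choices by `e_i ∈ {0, 1}`, with positions counted from `0`,
the entry at position `i` is `1 + i e_i + T_i`, where `T_i = ∑_{j > i} (1 - e_j)`
(`toPoint_image_Av`). For `n = m + 1` this is an injective affine map of `(e_1, …, e_m)`, so the
polytope is a parallelepiped and its relative interior is the image of the open cube
(`intrinsicInterior_avoidingPermutohedron`).

For a point `x` in that image put `N_k = (k + 1) T_k`. Then `x_0 = 1 + N_0`,
`x_{k+1} = k + 2 + N_{k+1} - N_k` and `N_m = 0`, so `x` is a lattice point if and only if all `N_k`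
are integers. The condition `0 < e_{k+1} < 1` becomes `0 < N_k / (k + 1) - N_{k+1} / (k + 2) < 1`.
Hence the lattice points correspond to the integer sequences of this kind that end in `N_m = 0`
(`latticePoints_cubeMap_image`).

Given `N_{k+1}`, the value `N_k` is confined to an open interval of length `k + 1`. If `k + 2` divides
`N_{k+1}`, the end points are multiples of `k + 1` and `N_k` represents every nonzero residue modulo
`k + 1` once; otherwise it represents every residue once (`window_eq`). The number of sequences ending
in `N_m = a` therefore depends only on whether `m + 1` divides `a`. If `z_m` and `p_m` are the numbers
in the divisible and in the other case, then `z_{m+1} = m p_m` and `p_{m+1} = m p_m + z_m`. So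
`z_{m+1} = m (z_m + z_{m-1})`, which is the recurrence of the derangement numbers, with the same
initial values (`finite_and_card_chains`).
-/

namespace PatternPolytope

/-! ### Permutations whose prefixes are intervals -/

theorem contains_of_strictMono {n : ℕ} {σ : Equiv.Perm (Fin n)} (τ : Equiv.Perm (Fin 3))
    {f : Fin 3 → Fin n} (hf : StrictMono f) (h : StrictMono fun c => σ (f (τ.symm c))) :
    Contains σ ⟨3, τ⟩ :=
  ⟨OrderEmbedding.ofStrictMono f hf, fun a b => by
    simpa using h.lt_iff_lt (a := τ a) (b := τ b)⟩

/-- A permutation avoids `132` and `312` exactly when none of its entries lies strictly between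
two earlier ones. -/
theorem mem_Av_iff {n : ℕ} {σ : Equiv.Perm (Fin n)} :
    σ ∈ Av n {pattern132, pattern312} ↔
      ∀ i j k, i < k → j < k → σ i < σ k → ¬ σ k < σ j := by
  constructor
  · intro h i j k hik hjk h1 h2
    rcases lt_trichotomy i j with hij | rfl | hij
    · refine h pattern132 (by simp) (contains_of_strictMono pattern132.2 (f := ![i, j, k]) ?_ ?_) <;>
        rw [Fin.strictMono_iff_lt_succ, Fin.forall_fin_two]
      exacts [⟨hij, hjk⟩, ⟨h1, h2⟩]
    · exact lt_asymm h1 h2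
    · refine h pattern312 (by simp) (contains_of_strictMono pattern312.2 (f := ![j, i, k]) ?_ ?_) <;>
        rw [Fin.strictMono_iff_lt_succ, Fin.forall_fin_two]
      exacts [⟨hij, hik⟩, ⟨h1, h2⟩]
  · rintro h π hπ ⟨f, hf⟩
    rcases hπ with rfl | rfl
    all_goals
      have h02 : f (0 : Fin 3) < f (2 : Fin 3) := f.strictMono (show (0 : Fin 3) < 2 by decide)
      have h12 : f (1 : Fin 3) < f (2 : Fin 3) := f.strictMono (show (1 : Fin 3) < 2 by decide)
    · exact h _ _ _ h02 h12 ((hf (0 : Fin 3) (2 : Fin 3)).2 (by decide))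
        ((hf (2 : Fin 3) (1 : Fin 3)).2 (by decide))
    · exact h _ _ _ h12 h02 ((hf (1 : Fin 3) (2 : Fin 3)).2 (by decide))
        ((hf (2 : Fin 3) (0 : Fin 3)).2 (by decide))

/-- For `e ∈ {0, 1}ⁿ` this is the one-line notation of the permutation in which the entry at
position `i` exceeds all earlier entries if `e i = 1`, and is smaller than all of them if `e i = 0`.
The value `e 0` has no influence, since its coefficient is `0`. -/
def cubePoint {n : ℕ} (e : Fin n → ℝ) : Fin n → ℝ :=
  fun i => 1 + (i : ℕ) * e i + ∑ j ∈ Finset.Ioi i, (1 - e j)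

theorem toPoint_eq_cubePoint {n : ℕ} {σ : Equiv.Perm (Fin n)} {e : Fin n → ℝ}
    (he : ∀ i, e i = 0 ∨ e i = 1) (h1 : ∀ i j, i < j → e j = 1 → σ i < σ j)
    (h0 : ∀ i j, i < j → e j = 0 → σ j < σ i) : toPoint σ = cubePoint e := by
  funext i
  -- The entry at position `i` is the number of smaller entries, plus one.
  have hσ : (σ i : ℕ) = (Finset.univ.filter fun j => σ j < σ i).card := by
    rw [← Fin.card_Iio (σ i), ← Finset.card_map σ.symm.toEmbedding]
    congr 1
    ext j
    simp [Finset.mem_map_equiv]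
  have hsplit : (Finset.univ.filter fun j => σ j < σ i) =
      ((Finset.Iio i).filter fun j => σ j < σ i) ∪ ((Finset.Ioi i).filter fun j => σ j < σ i) := by
    ext j
    rcases lt_trichotomy j i with h | rfl | h <;> simp [*, lt_asymm]
  have hdisj : Disjoint ((Finset.Iio i).filter fun j => σ j < σ i)
      ((Finset.Ioi i).filter fun j => σ j < σ i) := by
    rw [Finset.disjoint_left]
    intro j hj hj'
    simp only [Finset.mem_filter, Finset.mem_Iio, Finset.mem_Ioi] at hj hj'
    exact lt_asymm hj.1 hj'.1
  have hlow : ((((Finset.Iio i).filter fun j => σ j < σ i).card : ℕ) : ℝ) = (i : ℕ) * e i := by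
    rcases he i with h | h
    · rw [h, mul_zero, Nat.cast_eq_zero, Finset.card_eq_zero, Finset.filter_eq_empty_iff]
      intro j hj
      exact (h0 j i (Finset.mem_Iio.1 hj) h).not_gt
    · rw [h, mul_one, Finset.filter_true_of_mem, Fin.card_Iio]
      intro j hj
      exact h1 j i (Finset.mem_Iio.1 hj) h
  have hhigh : ((((Finset.Ioi i).filter fun j => σ j < σ i).card : ℕ) : ℝ) =
      ∑ j ∈ Finset.Ioi i, (1 - e j) := by
    rw [Finset.card_filter, Nat.cast_sum]
    refine Finset.sum_congr rfl fun j hj => ?_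
    rw [Finset.mem_Ioi] at hj
    rcases he j with h | h
    · simp [h, h0 i j hj h]
    · simp [h, (h1 i j hj h).not_gt]
  rw [toPoint, hσ, hsplit, Finset.card_union_of_disjoint hdisj, Nat.cast_add, hlow, hhigh, cubePoint]
  ring

open Classical in
/-- Every vertex of the cube is attained: the prescribed choices of "larger" and "smaller" are those
of a permutation. -/
theorem exists_perm_of_cube_vertex {n : ℕ} (e : Fin n → ℝ) (he : ∀ i, e i = 0 ∨ e i = 1) :
    ∃ σ : Equiv.Perm (Fin n), (∀ i j, i < j → e j = 1 → σ i < σ j) ∧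
      ∀ i j, i < j → e j = 0 → σ j < σ i := by
  let Z : Fin n → Finset (Fin n) := fun i => (Finset.Ioi i).filter fun j => e j = 0
  let v : Fin n → ℕ := fun i => (if e i = 1 then (i : ℕ) else 0) + (Z i).card
  have hZ : ∀ i, (Z i).card ≤ n - 1 - i := fun i => by
    rw [← Fin.card_Ioi]; exact Finset.card_filter_le _ _
  have hv : ∀ i, v i < n := by
    intro i
    have := hZ i
    have := i.2
    simp only [v]
    split_ifs <;> lia
  have hup : ∀ i j, i < j → e j = 1 → v i < v j := by
    intro i j hij hj
    -- The zeros after `i` lie strictly between `i` and `j`, or after `j`.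
    have hsub : Z i ⊆ Finset.Ioo i j ∪ Z j := by
      intro k hk
      simp only [Z, Finset.mem_filter, Finset.mem_Ioi, Finset.mem_union, Finset.mem_Ioo] at hk ⊢
      rcases lt_trichotomy k j with h | rfl | h
      · exact Or.inl ⟨hk.1, h⟩
      · rw [hj] at hk; exact absurd hk.2 one_ne_zero
      · exact Or.inr ⟨h, hk.2⟩
    have := (Finset.card_le_card hsub).trans (Finset.card_union_le _ _)
    rw [Fin.card_Ioo] at this
    have hij' : (i : ℕ) < j := hij
    simp only [v, if_pos hj]
    split_ifs <;> lia
  have hdown : ∀ i j, i < j → e j = 0 → v j < v i := by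
    intro i j hij hj
    have hsub : insert j (Z j) ⊆ Z i := by
      intro k hk
      simp only [Z, Finset.mem_filter, Finset.mem_Ioi, Finset.mem_insert] at hk ⊢
      rcases hk with rfl | hk
      · exact ⟨hij, hj⟩
      · exact ⟨hij.trans hk.1, hk.2⟩
    have hc := Finset.card_le_card hsub
    rw [Finset.card_insert_of_notMem (by simp [Z])] at hc
    simp only [v, hj, zero_ne_one, if_false]
    lia
  have hinj : Function.Injective fun i => (⟨v i, hv i⟩ : Fin n) := by
    have key : ∀ i j, i < j → v i ≠ v j := fun i j hij =>
      (he j).elim (fun h => (hdown i j hij h).ne') fun h => (hup i j hij h).ne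
    intro i j hij
    rw [Fin.mk.injEq] at hij
    by_contra hne
    rcases lt_or_gt_of_ne hne with h | h
    · exact key i j h hij
    · exact key j i h hij.symm
  exact ⟨Equiv.ofBijective _ (Finite.injective_iff_bijective.1 hinj), hup, hdown⟩

theorem toPoint_image_Av (n : ℕ) :
    toPoint '' Av n {pattern132, pattern312} = cubePoint '' {e | ∀ i, e i = 0 ∨ e i = 1} := by
  ext x
  constructor
  · rintro ⟨σ, hσ, rfl⟩
    rw [mem_Av_iff] at hσ
    refine ⟨fun k => if ∀ i, i < k → σ i < σ k then 1 else 0, fun k => ?_, ?_⟩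
    · exact (Classical.em _).elim (fun h => Or.inr (if_pos h)) fun h => Or.inl (if_neg h)
    · refine (toPoint_eq_cubePoint (fun k => ?_) (fun i j hij h => ?_) fun i j hij h => ?_).symm
      · exact (Classical.em _).elim (fun h => Or.inr (if_pos h)) fun h => Or.inl (if_neg h)
      · by_contra hn
        have hall : ¬ ∀ i, i < j → σ i < σ j := fun hall => hn (hall i hij)
        exact zero_ne_one ((if_neg hall).symm.trans h)
      · have hall : ¬ ∀ i, i < j → σ i < σ j := fun hall =>
          one_ne_zero ((if_pos hall).symm.trans h)
        push Not at hall
        obtain ⟨k, hkj, hk⟩ := hall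
        have hk' : σ j < σ k := lt_of_le_of_ne hk fun h => hkj.ne' (σ.injective h)
        have hne : σ i ≠ σ j := fun h => hij.ne (σ.injective h)
        exact lt_of_le_of_ne (not_lt.1 fun hlt => hσ i k j hij hkj hlt hk') hne.symm
  · rintro ⟨e, he, rfl⟩
    obtain ⟨σ, h1, h0⟩ := exists_perm_of_cube_vertex e he
    refine ⟨σ, ?_, toPoint_eq_cubePoint he h1 h0⟩
    rw [mem_Av_iff]
    intro i j k hik hjk hlt hgt
    rcases he k with h | h
    · exact lt_asymm hlt (h0 i k hik h)
    · exact lt_asymm hgt (h1 j k hjk h)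

/-! ### Relative interiors of affine images -/

/-- An injective affine map between finite-dimensional spaces is a homeomorphism onto its range,
which is the affine span of the image of any set with interior points. -/
theorem intrinsicInterior_image_of_injective {E F : Type*} [NormedAddCommGroup E]
    [NormedSpace ℝ E] [FiniteDimensional ℝ E] [NormedAddCommGroup F] [NormedSpace ℝ F]
    [FiniteDimensional ℝ F] (f : E →ᵃ[ℝ] F) (hf : Function.Injective f) {C : Set E}
    (hC : (interior C).Nonempty) :
    intrinsicInterior ℝ (f '' C) = f '' interior C := by
  have hfc : Continuous f := f.continuous_of_finiteDimensional
  obtain ⟨g, hgc, hg⟩ : ∃ g : F → E, Continuous g ∧ ∀ x, g (f x) = x := by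
    obtain ⟨l, hl⟩ := f.linear.exists_leftInverse_of_injective
      (LinearMap.ker_eq_bot.2 (f.linear_injective_iff.2 hf))
    refine ⟨fun y => l (y - f 0), ?_, fun x => ?_⟩
    · exact l.continuous_of_finiteDimensional.comp (continuous_id.sub continuous_const)
    · have h1 : f x - f 0 = f.linear x := by
        simpa using (f.linearMap_vsub x 0).symm
      change l (f x - f 0) = x
      rw [h1, ← LinearMap.comp_apply, hl, LinearMap.id_apply]
  have hspan : ∀ y, y ∈ affineSpan ℝ (f '' C) ↔ ∃ x, f x = y := by
    intro y
    have hC' : affineSpan ℝ C = ⊤ :=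
      affineSpan_eq_top_of_nonempty_interior
        (hC.mono (interior_mono (subset_convexHull ℝ C)))
    rw [← AffineSubspace.map_span, hC']
    simp
  ext y
  rw [mem_intrinsicInterior]
  constructor
  · rintro ⟨⟨y, hy⟩, hyi, rfl⟩
    obtain ⟨x, rfl⟩ := (hspan y).1 hy
    refine ⟨x, ?_, rfl⟩
    let F' : E → affineSpan ℝ (f '' C) := fun x => ⟨f x, (hspan _).2 ⟨x, rfl⟩⟩
    have hF' : Continuous F' := hfc.subtype_mk _
    have hsub : F' ⁻¹' ((↑) ⁻¹' (f '' C) : Set (affineSpan ℝ (f '' C))) ⊆ C := by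
      rintro z ⟨w, hw, hwz⟩
      rwa [← hf hwz]
    exact interior_mono hsub (preimage_interior_subset_interior_preimage hF' hyi)
  · rintro ⟨x, hx, rfl⟩
    refine ⟨⟨f x, (hspan _).2 ⟨x, rfl⟩⟩, ?_, rfl⟩
    let G : affineSpan ℝ (f '' C) → E := fun y => g y
    have hG : Continuous G := hgc.comp continuous_subtype_val
    have hsub : G ⁻¹' C ⊆ ((↑) ⁻¹' (f '' C) : Set (affineSpan ℝ (f '' C))) := by
      rintro ⟨y, hy⟩ hyC
      obtain ⟨z, rfl⟩ := (hspan y).1 hy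
      exact ⟨z, by simpa [G, hg] using hyC, rfl⟩
    refine interior_mono hsub (preimage_interior_subset_interior_preimage hG ?_)
    simpa [G, hg] using hx

/-! ### The polytope as an affine image of a cube -/

/-- The linear embedding of `ℝᵐ` into `ℝᵐ⁺¹` that inserts a zero in front. -/
def consZero (m : ℕ) : (Fin m → ℝ) →ₗ[ℝ] (Fin (m + 1) → ℝ) :=
  LinearMap.pi (Fin.cons 0 fun j => LinearMap.proj j)

@[simp]
theorem consZero_zero {m : ℕ} (e : Fin m → ℝ) : consZero m e 0 = 0 := rfl

@[simp]
theorem consZero_succ {m : ℕ} (e : Fin m → ℝ) (j : Fin m) : consZero m e j.succ = e j := rfl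

/-- `cubePoint` as an affine map in the coordinates it depends on. -/
def cubeMap (m : ℕ) : (Fin m → ℝ) →ᵃ[ℝ] (Fin (m + 1) → ℝ) where
  toFun e := cubePoint (consZero m e)
  linear :=
    { toFun := fun e i =>
        (i : ℕ) * consZero m e i - ∑ j ∈ Finset.Ioi i, consZero m e j
      map_add' := fun x y => by
        funext i
        simp only [map_add, Pi.add_apply, Finset.sum_add_distrib]
        ring
      map_smul' := fun c x => by
        funext i
        simp only [map_smul, Pi.smul_apply, smul_eq_mul, ← Finset.mul_sum, RingHom.id_apply]
        ring }
  map_vadd' p v := by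
    funext i
    simp only [cubePoint, vadd_eq_add, map_add, Pi.add_apply, LinearMap.coe_mk, AddHom.coe_mk,
      Finset.sum_sub_distrib, Finset.sum_add_distrib]
    ring

theorem cubeMap_apply {m : ℕ} (e : Fin m → ℝ) : cubeMap m e = cubePoint (consZero m e) := rfl

theorem cubeMap_injective (m : ℕ) : Function.Injective (cubeMap m) := by
  intro x y h
  -- The coordinates are determined successively, the last one first.
  have key : ∀ i : Fin (m + 1), consZero m x i = consZero m y i := by
    intro i
    induction i using WellFoundedGT.induction with
    | ind i ih =>
      have hi := congrFun h i
      simp only [cubeMap_apply, cubePoint] at hi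
      rw [Finset.sum_congr rfl fun j hj => by rw [ih j (Finset.mem_Ioi.1 hj)], add_left_inj,
        add_right_inj] at hi
      cases i using Fin.cases with
      | zero => rfl
      | succ i => exact mul_left_cancel₀ (by simp [Fin.val_succ]; positivity) hi
  funext j
  simpa using key j.succ

theorem avoidingPermutohedron_eq (m : ℕ) :
    avoidingPermutohedron (m + 1) {pattern132, pattern312} =
      cubeMap m '' Set.univ.pi fun _ => Set.Icc 0 1 := by
  have hvert : toPoint '' Av (m + 1) {pattern132, pattern312} =
      cubeMap m '' Set.univ.pi fun _ => {0, 1} := by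
    rw [toPoint_image_Av]
    ext x
    constructor
    · rintro ⟨e, he, rfl⟩
      refine ⟨fun j => e j.succ, fun j _ => he j.succ, ?_⟩
      funext i
      have hs : ∀ j ∈ Finset.Ioi i, 1 - consZero m (fun j => e j.succ) j = 1 - e j := by
        intro j hj
        cases j using Fin.cases with
        | zero => simp at hj
        | succ j => rfl
      rw [cubeMap_apply, cubePoint, cubePoint, Finset.sum_congr rfl hs]
      cases i using Fin.cases with
      | zero => simp
      | succ i => rfl
    · rintro ⟨e, he, rfl⟩
      refine ⟨consZero m e, fun i => ?_, rfl⟩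
      cases i using Fin.cases with
      | zero => exact Or.inl rfl
      | succ i => exact he i trivial
  rw [avoidingPermutohedron, hvert, ← AffineMap.image_convexHull, convexHull_pi]
  simp only [convexHull_pair, segment_eq_Icc (zero_le_one' ℝ)]

theorem intrinsicInterior_avoidingPermutohedron (m : ℕ) :
    intrinsicInterior ℝ (avoidingPermutohedron (m + 1) {pattern132, pattern312}) =
      cubeMap m '' Set.univ.pi fun _ => Set.Ioo 0 1 := by
  have hint : interior (Set.univ.pi fun _ : Fin m => Set.Icc (0 : ℝ) 1) =
      Set.univ.pi fun _ => Set.Ioo 0 1 := by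
    rw [interior_pi_set Set.finite_univ]
    simp only [interior_Icc]
  rw [avoidingPermutohedron_eq, intrinsicInterior_image_of_injective _ (cubeMap_injective m), hint]
  rw [hint]
  exact ⟨fun _ => 1 / 2, fun _ _ => by norm_num⟩

/-! ### Counting integer chains -/

/-- The sequences of integers `N₀, …, N_m` ending in `N_m = a` for which
`0 < N_k / (k + 1) - N_{k+1} / (k + 2) < 1` for all `k < m`, the denominators being cleared. -/
def chains (m : ℕ) (a : ℤ) : Set (Fin (m + 1) → ℤ) :=
  {N | N (Fin.last m) = a ∧ ∀ k : Fin m,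
    0 < ((k : ℤ) + 2) * N k.castSucc - ((k : ℤ) + 1) * N k.succ ∧
    ((k : ℤ) + 2) * N k.castSucc - ((k : ℤ) + 1) * N k.succ < ((k : ℤ) + 1) * ((k : ℤ) + 2)}

/-- The possible values of `N_m` in a chain `N₀, …, N_{m+1}` that ends in `N_{m+1} = a`. -/
def window (m : ℕ) (a : ℤ) : Set ℤ :=
  {b | 0 < ((m : ℤ) + 2) * b - ((m : ℤ) + 1) * a ∧
    ((m : ℤ) + 2) * b - ((m : ℤ) + 1) * a < ((m : ℤ) + 1) * ((m : ℤ) + 2)}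

theorem snoc_mem_chains_iff {m : ℕ} {a b : ℤ} {N : Fin (m + 1) → ℤ} (hN : N (Fin.last m) = b) :
    (Fin.snoc N a : Fin (m + 2) → ℤ) ∈ chains (m + 1) a ↔ b ∈ window m a ∧ N ∈ chains m b := by
  subst hN
  simp only [chains, window, Set.mem_ofPred_eq, Fin.snoc_last, true_and, Fin.forall_fin_succ',
    Fin.val_castSucc, Fin.snoc_castSucc, Fin.val_last, Fin.succ_last, Fin.succ_castSucc]
  exact and_comm

theorem snoc_init_of_mem_chains {m : ℕ} {a : ℤ} {N : Fin (m + 2) → ℤ} (hN : N ∈ chains (m + 1) a) :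
    (Fin.snoc (Fin.init N) a : Fin (m + 2) → ℤ) = N := by
  rw [← hN.1, Fin.snoc_init_self]

/-- Removing the last entry of a chain. -/
def chainsSuccEquiv (m : ℕ) (a : ℤ) :
    chains (m + 1) a ≃ Σ b : window m a, chains m (b : ℤ) where
  toFun N :=
    have h := (snoc_mem_chains_iff rfl).1 (snoc_init_of_mem_chains N.2 ▸ N.2)
    ⟨⟨_, h.1⟩, ⟨_, h.2⟩⟩
  invFun x := ⟨Fin.snoc x.2.1 a, (snoc_mem_chains_iff x.2.2.1).2 ⟨x.1.2, x.2.2⟩⟩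
  left_inv N := Subtype.ext (snoc_init_of_mem_chains N.2)
  right_inv := by
    rintro ⟨⟨b, hb⟩, ⟨N, hN⟩⟩
    obtain rfl : N (Fin.last m) = b := hN.1
    have h : Fin.init (Fin.snoc N a : Fin (m + 2) → ℤ) = N := Fin.init_snoc (α := fun _ => ℤ) a N
    refine Sigma.subtype_ext (Subtype.ext ?_) h
    exact congrFun h (Fin.last m)

/-- The window consists of `m` or `m + 1` consecutive integers. It avoids the multiples of `m + 1`
in the first case, and contains exactly one of them in the second case. -/
theorem window_eq (m : ℕ) (a : ℤ) : ∃ W : Finset ℤ, (W : Set ℤ) = window m a ∧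
    (W.filter fun b => ¬ ((m : ℤ) + 1) ∣ b).card = m ∧
    (W.filter fun b => ((m : ℤ) + 1) ∣ b).card = if ((m : ℤ) + 2) ∣ a then 0 else 1 := by
  obtain ⟨q, r, hr0, hr, rfl⟩ : ∃ q r : ℤ, 0 ≤ r ∧ r < (m : ℤ) + 2 ∧ a = ((m : ℤ) + 2) * q + r :=
    ⟨a / (m + 2), a % (m + 2), Int.emod_nonneg _ (by lia), Int.emod_lt_of_pos _ (by lia),
      (Int.mul_ediv_add_emod _ _).symm⟩
  have hmem : ∀ b, b ∈ window m (((m : ℤ) + 2) * q + r) ↔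
      ((m : ℤ) + 1) * q + (if r = 0 then 1 else r) ≤ b ∧ b ≤ ((m : ℤ) + 1) * q + r + m := by
    intro b
    -- In terms of `c` the window is `(m + 1) r < (m + 2) c < (m + 1) r + (m + 1) (m + 2)`.
    obtain ⟨c, rfl⟩ : ∃ c, b = ((m : ℤ) + 1) * q + c := ⟨b - ((m : ℤ) + 1) * q, by ring⟩
    have e : ((m : ℤ) + 2) * (((m : ℤ) + 1) * q + c) - ((m : ℤ) + 1) * (((m : ℤ) + 2) * q + r) =
        ((m : ℤ) + 2) * (c - r) + r := by ring
    simp only [window, Set.mem_ofPred_eq, e]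
    have hm : (0 : ℤ) ≤ m := by lia
    constructor
    · rintro ⟨h1, h2⟩
      split_ifs with h0
      · subst h0
        constructor
        · nlinarith
        · nlinarith
      · constructor
        · nlinarith
        · nlinarith
    · rintro ⟨h1, h2⟩
      split_ifs at h1 with h0
      · subst h0
        constructor
        · nlinarith
        · nlinarith
      · have : 0 < r := by lia
        constructor
        · nlinarith
        · nlinarith
  have hdvd : ((m : ℤ) + 2) ∣ ((m : ℤ) + 2) * q + r ↔ r = 0 := by
    rw [Int.dvd_add_right (dvd_mul_right _ _)]
    exact ⟨fun h => Int.eq_zero_of_dvd_of_nonneg_of_lt hr0 hr h, fun h => h ▸ dvd_zero _⟩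
  have hmul : ∀ b, ((m : ℤ) + 1) ∣ b → b ∈ window m (((m : ℤ) + 2) * q + r) →
      r ≠ 0 ∧ b = ((m : ℤ) + 1) * (q + 1) := by
    rintro _ ⟨c, rfl⟩ hb
    rw [hmem] at hb
    have h1 : q < c := by
      split_ifs at hb with h0
      · nlinarith
      · have : 0 < r := by lia
        nlinarith
    have h2 : c < q + 2 := by nlinarith
    obtain rfl : c = q + 1 := by lia
    refine ⟨fun h0 => ?_, rfl⟩
    subst h0
    nlinarith
  set W := Finset.Icc (((m : ℤ) + 1) * q + (if r = 0 then 1 else r)) (((m : ℤ) + 1) * q + r + m)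
    with hW
  have hWm : ∀ b, b ∈ W ↔ b ∈ window m (((m : ℤ) + 2) * q + r) := by
    intro b; rw [hmem, hW, Finset.mem_Icc]
  have hcard : W.card = m + if r = 0 then 0 else 1 := by
    rw [hW, Int.card_Icc]; split_ifs <;> lia
  have hfil : (W.filter fun b => ((m : ℤ) + 1) ∣ b).card = if r = 0 then 0 else 1 := by
    split_ifs with h0
    · rw [Finset.card_eq_zero, Finset.filter_eq_empty_iff]
      exact fun b hb hd => (hmul b hd ((hWm b).1 hb)).1 h0
    · rw [Finset.card_eq_one]
      refine ⟨((m : ℤ) + 1) * (q + 1), ?_⟩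
      ext b
      rw [Finset.mem_filter, Finset.mem_singleton]
      constructor
      · exact fun h => (hmul b h.2 ((hWm b).1 h.1)).2
      · rintro rfl
        refine ⟨?_, dvd_mul_right _ _⟩
        rw [hWm, hmem, if_neg h0, mul_add]
        lia
  refine ⟨W, Set.ext hWm, ?_, ?_⟩
  · have := Finset.card_filter_add_card_filter_not (s := W) (fun b => ((m : ℤ) + 1) ∣ b)
    lia
  · simp only [hdvd, hfil]

/-- Besides the derangement numbers, the number of chains with a final value that is not divisible
by `m + 1` enters the recursion. The two counts together satisfy the derangement recurrence
`D_{m+1} = m (D_m + D_{m-1})`. For `m = 0` the divisibility always holds, so that the truncated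
`m - 1` plays no part. -/
theorem finite_and_card_chains (m : ℕ) (a : ℤ) : Finite (chains m a) ∧
    Nat.card (chains m a) =
      numDerangements m + if ((m : ℤ) + 1) ∣ a then 0 else numDerangements (m - 1) := by
  induction m generalizing a with
  | zero =>
    have : chains 0 a = {fun _ => a} := by
      ext N
      simp only [chains, Set.mem_ofPred_eq, Set.mem_singleton_iff, IsEmpty.forall_iff, and_true]
      refine ⟨fun h => funext fun i => ?_, fun h => by rw [h]⟩
      rw [← h]; exact congrArg N (Fin.fin_one_eq_zero i)
    rw [this]
    refine ⟨inferInstance, ?_⟩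
    simp
  | succ m ih =>
    obtain ⟨W, hW, h1, h2⟩ := window_eq m a
    have e := chainsSuccEquiv m a
    rw [← hW] at e
    have hfin : ∀ b : (W : Set ℤ), Finite (chains m (b : ℤ)) := fun b => (ih b).1
    refine ⟨Finite.of_equiv _ e.symm, ?_⟩
    rw [Nat.card_congr e, Nat.card_sigma]
    simp only [fun b => (ih b).2]
    have hs : ∑ b : (W : Set ℤ), (numDerangements m +
        if ((m : ℤ) + 1) ∣ (b : ℤ) then 0 else numDerangements (m - 1)) =
        ∑ b ∈ W, (numDerangements m +
        if ((m : ℤ) + 1) ∣ b then 0 else numDerangements (m - 1)) :=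
      Finset.sum_coe_sort W (fun b => (numDerangements m +
        if ((m : ℤ) + 1) ∣ b then 0 else numDerangements (m - 1)))
    rw [hs, Finset.sum_add_distrib, Finset.sum_const, smul_eq_mul]
    have hsum : ∑ b ∈ W, (if ((m : ℤ) + 1) ∣ b then 0 else numDerangements (m - 1)) =
        m * numDerangements (m - 1) := by
      rw [Finset.sum_ite, Finset.sum_const_zero, zero_add, Finset.sum_const, h1, smul_eq_mul]
    have hc : W.card = m + if ((m : ℤ) + 2) ∣ a then 0 else 1 := by
      rw [← Finset.card_filter_add_card_filter_not (s := W) (fun b => ((m : ℤ) + 1) ∣ b), h1, h2,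
        add_comm]
    have hrec : m * numDerangements m + m * numDerangements (m - 1) = numDerangements (m + 1) := by
      cases m with
      | zero => simp
      | succ k => rw [numDerangements_add_two, Nat.add_sub_cancel]; ring
    have hd : ((m + 1 : ℕ) : ℤ) + 1 = (m : ℤ) + 2 := by push_cast; ring
    rw [hsum, hc, hd, ← hrec, Nat.add_sub_cancel]
    split_ifs <;> ring

theorem encard_chains_zero (m : ℕ) :
    (chains m 0).encard = (derangements (Fin m)).encard := by
  obtain ⟨hf, hc⟩ := finite_and_card_chains m 0
  rw [if_pos (dvd_zero _), add_zero, Nat.card_coe_set_eq] at hc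
  rw [← (Set.toFinite (chains m 0)).cast_ncard_eq, hc,
    ← (Set.toFinite (derangements (Fin m))).cast_ncard_eq, ← Nat.card_coe_set_eq,
    Nat.card_eq_fintype_card, card_derangements_fin_eq_numDerangements]

/-! ### Lattice points as integer chains -/

/-- The sum `T_i = ∑_{j > i} (1 - e_j)` that occurs in `cubePoint`. -/
def tailSum {n : ℕ} (e : Fin n → ℝ) (i : Fin n) : ℝ := ∑ j ∈ Finset.Ioi i, (1 - e j)

@[simp]
theorem tailSum_last {m : ℕ} (e : Fin (m + 1) → ℝ) : tailSum e (Fin.last m) = 0 := by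
  have : Finset.Ioi (Fin.last m) = ∅ := by
    ext j
    simp [Fin.le_last]
  rw [tailSum, this, Finset.sum_empty]

theorem tailSum_castSucc {m : ℕ} (e : Fin (m + 1) → ℝ) (k : Fin m) :
    tailSum e k.castSucc = (1 - e k.succ) + tailSum e k.succ := by
  have : Finset.Ioi k.castSucc = insert k.succ (Finset.Ioi k.succ) := by
    ext j
    simp [Fin.castSucc_lt_iff_succ_le, le_iff_eq_or_lt, eq_comm]
  rw [tailSum, this, Finset.sum_insert (by simp), tailSum]

/-- The point with first coordinate `1 + N₀` and coordinates `k + 2 + N_{k+1} - N_k` after it. -/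
def chainPoint {m : ℕ} (N : Fin (m + 1) → ℤ) : Fin (m + 1) → ℝ :=
  Fin.cons (1 + (N 0 : ℝ)) fun k => ((k : ℕ) : ℝ) + 2 + N k.succ - N k.castSucc

theorem chainPoint_injective (m : ℕ) :
    Function.Injective (chainPoint : (Fin (m + 1) → ℤ) → Fin (m + 1) → ℝ) := by
  intro N N' h
  funext i
  induction i using Fin.induction with
  | zero => simpa [chainPoint] using congrFun h 0
  | succ k ih => simpa [chainPoint, ih] using congrFun h k.succ

/-- With `N_k = (k + 1) T_k` the coordinates of a point in the image of the cube become integral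
combinations of the `N_k`. -/
theorem cubePoint_eq_chainPoint {m : ℕ} {e : Fin (m + 1) → ℝ} {N : Fin (m + 1) → ℤ}
    (h : ∀ k : Fin (m + 1), (N k : ℝ) = (((k : ℕ) : ℝ) + 1) * tailSum e k) :
    cubePoint e = chainPoint N := by
  funext i
  change 1 + ((i : ℕ) : ℝ) * e i + tailSum e i = chainPoint N i
  cases i using Fin.cases with
  | zero => simp [chainPoint, h]
  | succ k =>
    simp only [chainPoint, Fin.cons_succ, h, tailSum_castSucc, Fin.val_succ, Fin.val_castSucc]
    push_cast
    ring

/-- If `N_k = (k + 1) T_k`, the chain inequalities say that the coordinates `e_{k+1}` lie strictly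
between `0` and `1`. -/
theorem mem_chains_iff_of_tailSum {m : ℕ} {e : Fin m → ℝ} {N : Fin (m + 1) → ℤ}
    (h : ∀ k : Fin (m + 1), (N k : ℝ) = (((k : ℕ) : ℝ) + 1) * tailSum (consZero m e) k) :
    N ∈ chains m 0 ↔ e ∈ Set.univ.pi fun _ => Set.Ioo 0 1 := by
  have hlast : N (Fin.last m) = 0 := by
    have := h (Fin.last m)
    rw [tailSum_last, mul_zero] at this
    exact_mod_cast this
  have hk : ∀ k : Fin m, ((((k : ℤ) + 2) * N k.castSucc - ((k : ℤ) + 1) * N k.succ : ℤ) : ℝ) =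
      (1 - e k) * ((((k : ℕ) : ℝ) + 1) * (((k : ℕ) : ℝ) + 2)) := by
    intro k
    push_cast
    rw [h, h, tailSum_castSucc, consZero_succ, Fin.val_succ, Fin.val_castSucc]
    push_cast
    ring
  simp only [chains, Set.mem_ofPred_eq, hlast, true_and, Set.mem_univ_pi, Set.mem_Ioo]
  refine forall_congr' fun k => ?_
  have hpos : (0 : ℝ) < (((k : ℕ) : ℝ) + 1) * (((k : ℕ) : ℝ) + 2) := by positivity
  have hcast : ((((k : ℤ) + 1) * ((k : ℤ) + 2) : ℤ) : ℝ) =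
      (((k : ℕ) : ℝ) + 1) * (((k : ℕ) : ℝ) + 2) := by push_cast; rfl
  rw [← Int.cast_lt (R := ℝ), ← Int.cast_lt (R := ℝ) (n := ((k : ℤ) + 1) * ((k : ℤ) + 2)), hk, hcast,
    Int.cast_zero, mul_pos_iff_of_pos_right hpos, mul_lt_iff_lt_one_left hpos, sub_pos,
    sub_lt_self_iff]
  exact and_comm

theorem exists_tailSum_eq {m : ℕ} {N : Fin (m + 1) → ℤ} (hN : N (Fin.last m) = 0) :
    ∃ e : Fin m → ℝ, ∀ k : Fin (m + 1),
      (N k : ℝ) = (((k : ℕ) : ℝ) + 1) * tailSum (consZero m e) k := by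
  refine ⟨fun k => 1 - (N k.castSucc / (((k : ℕ) : ℝ) + 1) - N k.succ / (((k : ℕ) : ℝ) + 2)),
    fun k => ?_⟩
  induction k using Fin.reverseInduction with
  | last => simp [hN]
  | cast k ih =>
    rw [Fin.val_succ] at ih
    push_cast at ih
    have h1 : ((k : ℕ) : ℝ) + 1 ≠ 0 := by positivity
    have h2 : ((k : ℕ) : ℝ) + 2 ≠ 0 := by positivity
    rw [tailSum_castSucc, consZero_succ, Fin.val_castSucc, ih]
    field_simp
    ring

/-- The numbers `(k + 1) T_k` belonging to a lattice point are integers, since they are the sums of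
`j + 1 - x_j` over `j > k`. -/
theorem exists_int_eq_tailSum {m : ℕ} {e : Fin (m + 1) → ℝ} {z : Fin (m + 1) → ℤ}
    (hz : ∀ i, cubePoint e i = z i) :
    ∃ N : Fin (m + 1) → ℤ, ∀ k, (N k : ℝ) = (((k : ℕ) : ℝ) + 1) * tailSum e k := by
  have key : ∀ k : Fin (m + 1), ∃ v : ℤ, (v : ℝ) = (((k : ℕ) : ℝ) + 1) * tailSum e k := by
    intro k
    induction k using Fin.reverseInduction with
    | last => exact ⟨0, by simp⟩
    | cast k ih =>
      obtain ⟨v, hv⟩ := ih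
      refine ⟨k + 2 + v - z k.succ, ?_⟩
      have hx : 1 + ((k.succ : ℕ) : ℝ) * e k.succ + tailSum e k.succ = z k.succ := hz k.succ
      push_cast
      rw [hv, ← hx, tailSum_castSucc, Fin.val_succ, Fin.val_castSucc]
      push_cast
      ring
  choose N hN using key
  exact ⟨N, hN⟩

theorem latticePoints_cubeMap_image (m : ℕ) :
    latticePoints (cubeMap m '' Set.univ.pi fun _ => Set.Ioo 0 1) = chainPoint '' chains m 0 := by
  ext x
  constructor
  · rintro ⟨⟨e, he, rfl⟩, z, hz⟩
    obtain ⟨N, hN⟩ := exists_int_eq_tailSum hz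
    exact ⟨N, (mem_chains_iff_of_tailSum hN).2 he, (cubePoint_eq_chainPoint hN).symm⟩
  · rintro ⟨N, hN, rfl⟩
    obtain ⟨e, he⟩ := exists_tailSum_eq hN.1
    refine ⟨⟨e, (mem_chains_iff_of_tailSum he).1 hN, cubePoint_eq_chainPoint he⟩,
      Fin.cons (1 + N 0) fun k => (k : ℤ) + 2 + N k.succ - N k.castSucc, fun i => ?_⟩
    cases i using Fin.cases with
    | zero => simp [chainPoint]
    | succ k => simp [chainPoint]

end PatternPolytope

theorem mainTheorem8 (n : ℕ) (hn : 1 ≤ n) :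
    (PatternPolytope.latticePoints
      (intrinsicInterior ℝ
        (PatternPolytope.avoidingPermutohedron n
          {PatternPolytope.pattern132, PatternPolytope.pattern312}))).encard =
      (derangements (Fin (n - 1))).encard := by
  obtain ⟨m, rfl⟩ := Nat.exists_eq_add_of_le' hn
  rw [PatternPolytope.intrinsicInterior_avoidingPermutohedron,
    PatternPolytope.latticePoints_cubeMap_image,
    (PatternPolytope.chainPoint_injective m).injOn.encard_image,
    PatternPolytope.encard_chains_zero, Nat.add_sub_cancel]
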